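/- Let $T$ be a complete first-order theory in a language $L$, let $\kappa>|L|+\aleph_0$ be a cardinal, and let $\mathbb M\models T$ be a $\kappa$-saturated model (for instance a monster model of $T$). All tuples below are tuples of elements of $\mathbb M$, and consistency of a set of formulas with parameters in $\mathbb M$ means finite satisfiability in $\mathbb M$. A formula $\varphi(x;y)$ has SOP$_1$ (modulo $T$) if in some model of $T$ there is a tree of tuples $(a_\eta)_{\eta\in 2^{<\omega}}$ such that $\{\varphi(x;a_{\eta\restriction n}):n<\omega\}$ is consistent for every $\eta\in 2^{\omega}$, and $\{\varphi(x;a_\eta),\varphi(x;a_{\nu\frown\langle 1\rangle})\}$ is inconsistent whenever $\nu\frown\langle 0\rangle\unlhd\eta$. The theory $T$ has SOP$_1$ if some formula has SOP$_1$ modulo $T$. For an elementary substructure $M\prec\mathbb M$ with $|M|<\kappa$, a tuple $a$ and a set (or tuple) $B$: - $a\perp^{u}_M B$ means that $\mathrm{tp}(a/MB)$ is finitely satisfiable in $M$. - A formula $\varphi(x;b)$ *Kim-divides* over $M$ if there are a global type $q\in S(\mathbb M)$ which is $M$-invariant and extends $\mathrm{tp}(b/M)$, and a Morley sequence $\langle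 b_i:i<\omega\rangle$ in $q$ over $M$ (that is, $b_i\models q|_{Mb_{<i}}$ for all $i$), such that $\{\varphi(x;b_i):i<\omega\}$ is inconsistent. It *Kim-forks* over $M$ if it implies a finite disjunction of formulas each of which Kim-divides over $M$, and a type Kim-forks over $M$ if it implies a formula that Kim-forks over $M$. - $a$ is *Kim-independent* from $B$ over $M$, written $a\perp^{K}_M B$, if $\mathrm{tp}(a/MB)$ does not Kim-fork over $M$. **Proposition.** If $T$ has SOP$_1$, then there are models $M\prec N\prec\mathbb M$ of $T$ with $|N|<\kappa$ and finite tuples $a$ and $c$ from $\mathbb M$ such that $a\perp^{u}_M N$ and $a\perp^{u}_N c$, but $a\not\perp^{K}_M Nc$. -/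

import Mathlib

/-!
Conventions. `𝕄` is an ambient `L`-structure (a sufficiently saturated model of a complete theory).
Tuples are functions `a : α → 𝕄`. A formula `φ(x; b)` with parameters is a formula
`φ : L.Formula (α ⊕ β)` together with a tuple `b : β → 𝕄`; a formula over a set `A` of parameters is
an element of `L.Formula (α ⊕ A)`, each element of `A` standing for itself, and a formula over the
whole of `𝕄` is an element of `L.Formula (α ⊕ 𝕄)`.
-/

open FirstOrder Cardinal

universe u v w

namespace KimIndependence

open FirstOrder.Language

/-- The family of formulas `φ i (x; b i)`, `i : ι`, is consistent: every finite subfamily is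
realized in `𝕄`. -/
def Consistent {L : FirstOrder.Language.{u, v}} {𝕄 : Type w} [L.Structure 𝕄] {α β ι : Type*}
    (φ : ι → L.Formula (α ⊕ β)) (b : ι → β → 𝕄) : Prop :=
  ∀ s : Finset ι, ∃ a : α → 𝕄, ∀ i ∈ s, (φ i).Realize (Sum.elim a (b i))

/-! ### The property SOP₁ -/

/-- `φ(x; y)` has SOP₁ in `𝕄`: there is a tree `(a_η)`, indexed by finite binary words `η`
(`false` is `0`, `true` is `1`), such that the formulas along each branch are consistent, and
`φ(x; a_η)`, `φ(x; a_{ν⌢1})` are inconsistent whenever `η` extends `ν⌢0`. -/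
def FormulaHasSOP1 {L : FirstOrder.Language.{u, v}} (𝕄 : Type w) [L.Structure 𝕄] {α β : Type*}
    (φ : L.Formula (α ⊕ β)) : Prop :=
  ∃ a : List Bool → β → 𝕄,
    (∀ η : ℕ → Bool,
      Consistent (fun _ : ℕ => φ) (fun n => a (List.ofFn fun i : Fin n => η i))) ∧
    (∀ ν η : List Bool, (ν ++ [false]) <+: η →
      ¬ ∃ x : α → 𝕄,
        φ.Realize (Sum.elim x (a η)) ∧ φ.Realize (Sum.elim x (a (ν ++ [true]))))

/-- `T` has SOP₁: some formula `φ(x; y)` in finite tuples of variables has SOP₁ in a model of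
`T`. -/
def HasSOP1 {L : FirstOrder.Language.{u, v}} (T : L.Theory) : Prop :=
  ∃ (m n : ℕ) (φ : L.Formula (Fin m ⊕ Fin n))
    (𝕌 : FirstOrder.Language.Theory.ModelType.{u, v, max u v} T), FormulaHasSOP1 𝕌 φ

/-! ### Types and saturation -/

/-- `a` realizes the set `p` of formulas over `A`. -/
def Realizes {L : FirstOrder.Language.{u, v}} {𝕄 : Type w} [L.Structure 𝕄] {α : Type*} {A : Set 𝕄}
    (a : α → 𝕄) (p : Set (L.Formula (α ⊕ A))) : Prop :=
  ∀ φ ∈ p, φ.Realize (Sum.elim a (fun c : A => (c : 𝕄)))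

/-- `𝕄` is `κ`-saturated: every 1-type (finitely satisfiable set of formulas in one variable) over
a set of fewer than `κ` parameters is realized in `𝕄`. -/
def IsSaturated (L : FirstOrder.Language.{u, v}) (𝕄 : Type w) [L.Structure 𝕄] (κ : Cardinal.{w}) : Prop :=
  ∀ A : Set 𝕄, #A < κ → ∀ p : Set (L.Formula (Fin 1 ⊕ A)),
    (∀ s : Finset (L.Formula (Fin 1 ⊕ A)), (s : Set (L.Formula (Fin 1 ⊕ A))) ⊆ p →
      ∃ a : Fin 1 → 𝕄, Realizes a (s : Set (L.Formula (Fin 1 ⊕ A)))) →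
    ∃ a : Fin 1 → 𝕄, Realizes a p

/-- `tp(a/A)`. -/
def typeOver (L : FirstOrder.Language.{u, v}) {𝕄 : Type w} [L.Structure 𝕄] {α : Type*}
    (a : α → 𝕄) (A : Set 𝕄) : Set (L.Formula (α ⊕ A)) :=
  {φ | φ.Realize (Sum.elim a (fun c : A => (c : 𝕄)))}

/-- A global type in the variables `α`: a complete, finitely satisfiable set of formulas over
`𝕄`. -/
structure GlobalType (L : FirstOrder.Language.{u, v}) (𝕄 : Type w) [L.Structure 𝕄] (α : Type*) where
  carrier : Set (L.Formula (α ⊕ 𝕄))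
  finSat : ∀ s : Finset (L.Formula (α ⊕ 𝕄)), (s : Set (L.Formula (α ⊕ 𝕄))) ⊆ carrier →
    ∃ a : α → 𝕄, ∀ φ ∈ s, φ.Realize (Sum.elim a id)
  complete : ∀ φ : L.Formula (α ⊕ 𝕄), φ ∈ carrier ∨ φ.not ∈ carrier

/-- `φ(x; b) ∈ q`. -/
def GlobalType.Contains {L : FirstOrder.Language.{u, v}} {𝕄 : Type w} [L.Structure 𝕄] {α β : Type*}
    (q : GlobalType L 𝕄 α) (φ : L.Formula (α ⊕ β)) (b : β → 𝕄) : Prop :=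
  φ.relabel (Sum.map id b) ∈ q.carrier

/-- The global type `q` is `A`-invariant: if `b ≡_A b'` then `φ(x; b) ∈ q ↔ φ(x; b') ∈ q`. -/
def GlobalType.IsInvariant {L : FirstOrder.Language.{u, v}} {𝕄 : Type w} [L.Structure 𝕄] {α : Type*}
    (q : GlobalType L 𝕄 α) (A : Set 𝕄) : Prop :=
  ∀ (n : ℕ) (φ : L.Formula (α ⊕ Fin n)) (b b' : Fin n → 𝕄),
    typeOver L b A = typeOver L b' A → (q.Contains φ b ↔ q.Contains φ b')

/-- The restriction `q|_B`. -/
def GlobalType.restrict {L : FirstOrder.Language.{u, v}} {𝕄 : Type w} [L.Structure 𝕄] {α : Type*}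
    (q : GlobalType L 𝕄 α) (B : Set 𝕄) : Set (L.Formula (α ⊕ B)) :=
  {φ | q.Contains φ (fun c : B => (c : 𝕄))}

/-- `(b i)_{i < ω}` is a Morley sequence in `q` over `A`: each `b i` realizes
`q|_{A ∪ {b j : j < i}}`. -/
def IsMorleySeq {L : FirstOrder.Language.{u, v}} {𝕄 : Type w} [L.Structure 𝕄] {α : Type*}
    (q : GlobalType L 𝕄 α) (A : Set 𝕄) (b : ℕ → α → 𝕄) : Prop :=
  ∀ i : ℕ, Realizes (b i) (q.restrict (A ∪ ⋃ j : Fin i, Set.range (b j)))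

/-! ### Independence relations over models -/

section Independence

variable {L : FirstOrder.Language.{u, v}} {𝕄 : Type w} [L.Structure 𝕄]

/-- `φ(x; b)` Kim-divides over the model `M`: there are a global `M`-invariant type
`q ⊇ tp(b/M)` and a Morley sequence `(b_i)` in `q` over `M` such that `{φ(x; b_i) : i < ω}` is
inconsistent. -/
def KimDivides (M : L.ElementarySubstructure 𝕄) {α : Type*} {n : ℕ}
    (φ : L.Formula (α ⊕ Fin n)) (b : Fin n → 𝕄) : Prop :=
  ∃ q : GlobalType L 𝕄 (Fin n), q.IsInvariant (M : Set 𝕄) ∧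
    typeOver L b (M : Set 𝕄) ⊆ q.restrict (M : Set 𝕄) ∧
    ∃ I : ℕ → Fin n → 𝕄, IsMorleySeq q (M : Set 𝕄) I ∧ ¬ Consistent (fun _ : ℕ => φ) I

/-- `φ(x; b)` Kim-forks over `M`: it implies a finite disjunction of formulas `ψ j (x; c j)` that
each Kim-divide over `M`. -/
def KimForks (M : L.ElementarySubstructure 𝕄) {α : Type*} {n : ℕ}
    (φ : L.Formula (α ⊕ Fin n)) (b : Fin n → 𝕄) : Prop :=
  ∃ (k : ℕ) (m : Fin k → ℕ) (ψ : ∀ j : Fin k, L.Formula (α ⊕ Fin (m j)))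
    (c : ∀ j : Fin k, Fin (m j) → 𝕄),
    (∀ j, KimDivides M (ψ j) (c j)) ∧
    ∀ a : α → 𝕄, φ.Realize (Sum.elim a b) → ∃ j, (ψ j).Realize (Sum.elim a (c j))

/-- A type `p` over `A` Kim-forks over `M`: some `φ(x; b)` that Kim-forks over `M` is implied by
`p`, that is, by a finite subset of `p`. -/
def TypeKimForks (M : L.ElementarySubstructure 𝕄) {α : Type*} {A : Set 𝕄}
    (p : Set (L.Formula (α ⊕ A))) : Prop :=
  ∃ (n : ℕ) (φ : L.Formula (α ⊕ Fin n)) (b : Fin n → 𝕄),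
    (∃ s : Finset (L.Formula (α ⊕ A)), (s : Set (L.Formula (α ⊕ A))) ⊆ p ∧
      ∀ a : α → 𝕄, Realizes a (s : Set (L.Formula (α ⊕ A))) → φ.Realize (Sum.elim a b)) ∧
    KimForks M φ b

/-- `a` is Kim-independent from `B` over `M`: `tp(a/MB)` does not Kim-fork over `M`. -/
def KimIndep (M : L.ElementarySubstructure 𝕄) {α : Type*} (a : α → 𝕄) (B : Set 𝕄) : Prop :=
  ¬ TypeKimForks M (typeOver L a ((M : Set 𝕄) ∪ B))

/-- `a ⫝ᵘ_M B`: `tp(a/MB)` is finitely satisfiable in `M`, i.e. each formula of this type is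
satisfied by a tuple from `M`. -/
def CoheirIndep (M : L.ElementarySubstructure 𝕄) {α : Type*} (a : α → 𝕄) (B : Set 𝕄) : Prop :=
  ∀ φ ∈ typeOver L a ((M : Set 𝕄) ∪ B), ∃ a' : α → 𝕄, (∀ i, a' i ∈ M) ∧
    φ.Realize (Sum.elim a' (fun c : ((M : Set 𝕄) ∪ B : Set 𝕄) => (c : 𝕄)))

end Independence

end KimIndependence

/-! ### Definable sets -/

namespace Set.Definable

open FirstOrder FirstOrder.Language Set

variable {L : FirstOrder.Language.{u, v}} {M : Type w} [L.Structure M] {A : Set M}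

/-! SOP₁ is turned into an array inside a small model `M = ⋃ A i`: `c₀ i` and `c₁ i` have the same
type over `A i`, `a i` realizes `φ(x; c₀ j)` for `j ≤ i`, and `φ(x; c₁ j)`, `φ(x; c₀ i)` are
inconsistent for `j ≤ i` (`IsTreeOver.exists_array`). Each step replaces a tree by a limit of its
subtrees above first-level nodes (`IsTreeOver.exists_step`).

Average along a nonprincipal ultrafilter. The averages of `c₀` and `c₁` are global coheirs of one
and the same type over `M`. Let `a' i` realize the average of `a` over larger and larger sets
starting with `M`, whose union is a model `N` (`IsSaturated.exists_average_chain`); let `c` realize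
the average of `c₀` over `N`, and `d` the average of `a'` over `Nc`. Then `tp(d/Nc)` is finitely
satisfiable in `N`, and `tp(d/N)` in `M`, being the average of `a`. Every `a' i` realizes all `φ(x;
c₀ j)`, hence `φ(x; c)`, and so does `d`.

In a Morley sequence of the average of `c₁` over `M`, the first term also realizes the average of
`c₀` over `M`, so its instance of `φ` is inconsistent with every `φ(x; c₁ j)`, and therefore with
that of the second term. Thus `φ(x; c)` Kim-divides over `M`. -/

theorem definable_realize_left {α β : Type*} (φ : L.Formula (α ⊕ β)) {b : β → M}
    (hb : ∀ i, b i ∈ A) : A.Definable L {x : α → M | φ.Realize (Sum.elim x b)} := by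
  rw [definable_iff_exists_formula_sum]
  refine ⟨φ.relabel (Sum.elim Sum.inr fun i => Sum.inl ⟨b i, hb i⟩), ?_⟩
  ext x
  simp only [mem_ofPred_eq, Formula.realize_relabel]
  apply iff_of_eq
  congr 1
  ext i
  cases i <;> rfl

theorem definable_realize_right {α β : Type*} (φ : L.Formula (α ⊕ β)) {a : α → M}
    (ha : ∀ i, a i ∈ A) : A.Definable L {y : β → M | φ.Realize (Sum.elim a y)} := by
  convert definable_realize_left (φ.relabel Sum.swap) ha using 1
  ext y
  simp only [mem_ofPred_eq, Formula.realize_relabel, Sum.elim_swap]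

/-- Definable sets over `A` are given by formulas over `A`. -/
theorem exists_formula {α : Type*} {D : Set (α → M)} (hD : A.Definable L D) :
    ∃ φ : L.Formula (α ⊕ A), ∀ x, x ∈ D ↔ φ.Realize (Sum.elim x (fun c : A => (c : M))) := by
  obtain ⟨φ, rfl⟩ := definable_iff_exists_formula_sum.1 hD
  refine ⟨φ.relabel Sum.swap, fun x => ?_⟩
  simp only [mem_ofPred_eq, Formula.realize_relabel, Sum.elim_swap]

/-- Membership in a definable set depends on finitely many coordinates. -/
theorem exists_finset_coords {V : Type*} {D : Set (V → M)} (hD : A.Definable L D) :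
    ∃ F : Finset V, ∀ x y : V → M, (∀ i ∈ F, x i = y i) → (x ∈ D ↔ y ∈ D) := by
  classical
  obtain ⟨φ, rfl⟩ := hD
  refine ⟨φ.freeVarFinset, fun x y h => ?_⟩
  have hx := BoundedFormula.realize_restrictFreeVar' (φ := φ) (s := ↑φ.freeVarFinset)
    subset_rfl (v := x) (xs := default)
  have hy := BoundedFormula.realize_restrictFreeVar' (φ := φ) (s := ↑φ.freeVarFinset)
    subset_rfl (v := y) (xs := default)
  have hxy : (x ∘ (↑) : ↥(φ.freeVarFinset : Set V) → M) = y ∘ (↑) := funext fun i => h i i.2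
  simp only [mem_ofPred_eq, Formula.Realize]
  rw [← hx, ← hy, hxy]

/-- A set definable over an increasing union is definable over one of the pieces. -/
theorem exists_of_iUnion {V : Type*} {A : ℕ → Set M} (hA : Monotone A) {D : Set (V → M)}
    (hD : (⋃ i, A i).Definable L D) : ∃ i, (A i).Definable L D := by
  obtain ⟨F, hF, hD⟩ := definable_iff_finitely_definable.1 hD
  obtain ⟨i, hi⟩ := hA.directed_le.exists_mem_subset_of_finset_subset_biUnion (s := F) hF
  exact ⟨i, hD.mono hi⟩

theorem definable_eq_const {V : Type*} {a : M} (ha : a ∈ A) (i : V) :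
    A.Definable L {x : V → M | x i = a} :=
  (Set.Definable.singleton_of_mem L ha).preimage_comp fun _ : Fin 1 => i

theorem definable_eq_coord {V : Type*} (i j : V) : A.Definable L {x : V → M | x i = x j} :=
  (Set.Definable.diagonal L A).preimage_comp ![i, j]

/-- The possible values of the `k`-th coordinate, given the first `k` ones. -/
theorem fiber_image {D : Set (ℕ → M)} (hD : A.Definable L D) (k : ℕ) (v : ℕ → M) :
    (A ∪ v '' Set.Iio k).Definable L
      {x : Fin 1 → M | ∃ y ∈ D, (∀ j < k, y j = v j) ∧ y k = x 0} := by
  obtain ⟨F, hF⟩ := hD.exists_finset_coords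
  obtain ⟨K, hK, hFK⟩ : ∃ K, k < K ∧ ∀ i ∈ F, i < K := by
    refine ⟨(F.sup id + k) + 1, by omega, fun i hi => ?_⟩
    have := Finset.le_sup (f := id) hi
    simp only [id] at this
    omega
  -- `D` ignores the coordinates from `K` on, so these may all be sent to the free variable; a
  -- finite block of quantifiers then suffices.
  let r : ℕ → Fin 1 ⊕ Fin K := fun j => if h : j < K then Sum.inr ⟨j, h⟩ else Sum.inl 0
  have h0 : (A ∪ v '' Set.Iio k).Definable L
      {g : Fin 1 ⊕ Fin K → M | ∀ j : Fin k, g (r j) = v j} := by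
    have h (j : Fin k) : (A ∪ v '' Set.Iio k).Definable L
        {g : Fin 1 ⊕ Fin K → M | g (r j) = v j} :=
      definable_eq_const (Set.mem_union_right _ (Set.mem_image_of_mem v (Set.mem_Iio.2 j.2))) _
    convert Set.definable_iInter_of_finite h using 1
    ext g
    simp
  have h1 : (A ∪ v '' Set.Iio k).Definable L
      {g : Fin 1 ⊕ Fin K → M | (g ∘ r ∈ D ∧ ∀ j : Fin k, g (r j) = v j) ∧
        g (r k) = g (Sum.inl 0)} :=
    (((hD.mono Set.subset_union_left).preimage_comp r).inter h0).inter (definable_eq_coord _ _)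
  convert! h1.exists_of_finite using 1
  ext x
  simp only [mem_ofPred_eq]
  constructor
  · rintro ⟨y, hy, hyv, hyk⟩
    have hr : ∀ j < K, (Sum.elim x fun i : Fin K => y i) (r j) = y j := fun j hj => by
      simp [r, hj]
    refine ⟨fun i => y i, ⟨(hF _ _ fun i hi => hr i (hFK i hi)).2 hy, fun j => ?_⟩, ?_⟩
    · rw [hr j (j.2.trans hK), hyv j j.2]
    · rw [hr k hK, hyk]; rfl
  · rintro ⟨u, ⟨hu, huv⟩, huk⟩
    exact ⟨_, hu, fun j hj => huv ⟨j, hj⟩, huk⟩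

end Set.Definable

namespace KimIndependence

open FirstOrder.Language Filter

/-! ### Saturation in countably many variables -/

section Saturation

variable {L : FirstOrder.Language.{u, v}} {𝕄 : Type w} [L.Structure 𝕄] {κ : Cardinal.{w}}

/-- The formulas that hold eventually along a proper filter are finitely satisfiable, so filters can
stand for partial types. -/
theorem IsSaturated.exists_mem_of_unary (hsat : IsSaturated L 𝕄 κ) {A : Set 𝕄} (hA : #A < κ)
    (F : Filter (Fin 1 → 𝕄)) [F.NeBot] :
    ∃ x, ∀ D ∈ F, A.Definable L D → x ∈ D := by
  obtain ⟨x, hx⟩ := hsat A hA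
    {φ | ∀ᶠ x in F, φ.Realize (Sum.elim x (fun c : A => (c : 𝕄)))} fun s hs =>
      (((Filter.eventually_all_finset s).2 fun φ hφ => hs hφ).exists).imp fun x hx => hx
  refine ⟨x, fun D hDF hD => ?_⟩
  obtain ⟨φ, hφ⟩ := hD.exists_formula
  exact (hφ x).2 (hx φ (mem_of_superset hDF fun y hy => (hφ y).1 hy))

theorem card_union_lt (hκ : ℵ₀ < κ) {A B : Set 𝕄} (hA : #A < κ) (hB : B.Countable) :
    #(A ∪ B : Set 𝕄) < κ :=
  (mk_union_le A B).trans_lt (add_lt_of_lt hκ.le hA (hB.le_aleph0.trans_lt hκ))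

/-- A saturated structure realizes types in countably many variables. -/
theorem IsSaturated.exists_mem_nat (hsat : IsSaturated L 𝕄 κ) (hκ : ℵ₀ < κ) {A : Set 𝕄}
    (hA : #A < κ) (F : Filter (ℕ → 𝕄)) [F.NeBot] :
    ∃ x, ∀ D ∈ F, A.Definable L D → x ∈ D := by
  classical
  have hne : Nonempty 𝕄 := ⟨(Filter.nonempty_of_neBot F).some 0⟩
  -- `Q k v`: the first `k` coordinates of `v` are compatible with every definable set in `F`.
  let Q : ℕ → (ℕ → 𝕄) → Prop := fun k v =>
    ∀ D ∈ F, A.Definable L D → ∃ y ∈ D, ∀ j < k, y j = v j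
  have step : ∀ k v, Q k v → ∃ a, Q (k + 1) (Function.update v k a) := by
    intro k v hv
    let S := {D : Set (ℕ → 𝕄) // D ∈ F ∧ A.Definable L D}
    let E : S → Set (Fin 1 → 𝕄) := fun D =>
      {x | ∃ y ∈ D.1, (∀ j < k, y j = v j) ∧ y k = x 0}
    have : Nonempty S := ⟨⟨Set.univ, univ_mem, Set.definable_univ⟩⟩
    have hdir : Directed (· ≥ ·) fun D => 𝓟 (E D) := by
      intro D D'
      refine ⟨⟨D.1 ∩ D'.1, inter_mem D.2.1 D'.2.1, D.2.2.inter D'.2.2⟩, ?_, ?_⟩ <;>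
        refine principal_mono.2 ?_ <;> rintro x ⟨y, hy, hy'⟩
      exacts [⟨y, hy.1, hy'⟩, ⟨y, hy.2, hy'⟩]
    have : (⨅ D, 𝓟 (E D)).NeBot := by
      refine (iInf_neBot_iff_of_directed hdir).2 fun D => principal_neBot_iff.2 ?_
      obtain ⟨y, hy, hyv⟩ := hv D.1 D.2.1 D.2.2
      exact ⟨fun _ => y k, y, hy, hyv, rfl⟩
    -- The sets `E D` are definable over `A` and the `k` values already chosen, which is still a
    -- small set.
    obtain ⟨x, hx⟩ := hsat.exists_mem_of_unary
      (card_union_lt hκ hA ((Set.to_countable (Set.Iio k)).image v)) (⨅ D, 𝓟 (E D))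
    refine ⟨x 0, fun D hDF hD => ?_⟩
    obtain ⟨y, hy, hyv, hyk⟩ := hx (E ⟨D, hDF, hD⟩)
      (mem_iInf_of_mem (⟨D, hDF, hD⟩ : S) (mem_principal_self _)) (hD.fiber_image k v)
    refine ⟨y, hy, fun j hj => ?_⟩
    rcases Nat.lt_succ_iff_lt_or_eq.1 hj with hj | rfl
    · rw [Function.update_of_ne hj.ne, hyv j hj]
    · rw [Function.update_self, hyk]
  choose a ha using step
  let s : (k : ℕ) → {v // Q k v} := fun k => Nat.rec
    ⟨fun _ => hne.some, fun D hDF _ => ((Filter.nonempty_of_mem hDF).imp fun y hy =>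
      ⟨hy, fun j hj => absurd hj (Nat.not_lt_zero j)⟩)⟩
    (fun k v => ⟨Function.update v.1 k (a k v.1 v.2), ha k v.1 v.2⟩) k
  have hs : ∀ k j, j < k → (s k).1 j = (s (j + 1)).1 j := by
    intro k j hj
    induction k, (hj : j + 1 ≤ k) using Nat.le_induction with
    | base => rfl
    | succ k hk ih =>
      have : (s (k + 1)).1 = Function.update (s k).1 k (a k (s k).1 (s k).2) := rfl
      rw [this, Function.update_of_ne (by omega), ih]
  -- Coordinate `j` is fixed from stage `j + 1` on, and a definable `D` only sees finitely many
  -- coordinates.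
  refine ⟨fun j => (s (j + 1)).1 j, fun D hDF hD => ?_⟩
  obtain ⟨G, hG⟩ := hD.exists_finset_coords
  obtain ⟨y, hy, hyv⟩ := (s (G.sup id + 1)).2 D hDF hD
  refine (hG _ _ fun i hi => ?_).1 hy
  have : i < G.sup id + 1 := Nat.lt_succ_of_le (Finset.le_sup (f := id) hi)
  rw [hyv i this, hs _ _ this]

theorem IsSaturated.exists_mem (hsat : IsSaturated L 𝕄 κ) (hκ : ℵ₀ < κ) [Nonempty 𝕄] {A : Set 𝕄}
    (hA : #A < κ) {V : Type*} [Countable V] (F : Filter (V → 𝕄)) [F.NeBot] :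
    ∃ x, ∀ D ∈ F, A.Definable L D → x ∈ D := by
  obtain ⟨e, he⟩ := exists_injective_nat V
  obtain ⟨x, hx⟩ := hsat.exists_mem_nat hκ hA
    (F.map fun v => Function.extend e v fun _ => Classical.arbitrary 𝕄)
  refine ⟨x ∘ e, fun D hDF hD => hx _ ?_ (hD.preimage_comp e)⟩
  refine mem_map.2 (mem_of_superset hDF fun v hv => ?_)
  simpa only [Set.mem_preimage, Function.extend_comp he] using hv

end Saturation

end KimIndependence

namespace KimIndependence

open FirstOrder.Language Filter

/-! ### Skolem hulls -/

section Hull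

variable (L : FirstOrder.Language.{u, v}) {𝕄 : Type w} [L.Structure 𝕄] [Nonempty 𝕄]

/-- The elementary substructure generated by `A` under a choice of Skolem functions. -/
noncomputable def hull (A : Set 𝕄) : L.ElementarySubstructure 𝕄 :=
  (Substructure.closure (L.sum L.skolem₁) A).elementarySkolem₁Reduct

theorem coe_hull (A : Set 𝕄) :
    (hull L A : Set 𝕄) = (Substructure.closure (L.sum L.skolem₁) A : Set 𝕄) :=
  rfl

theorem subset_hull (A : Set 𝕄) : A ⊆ hull L A :=
  Substructure.subset_closure

/-- Closure under functions commutes with increasing unions; this makes the union of such a chain a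
model. -/
theorem coe_hull_iUnion {A : ℕ → Set 𝕄} (hA : ∀ i, (hull L (A i) : Set 𝕄) ⊆ A (i + 1)) :
    (hull L (⋃ i, A i) : Set 𝕄) = ⋃ i, A i := by
  refine Set.Subset.antisymm (fun x hx => ?_) (subset_hull L _)
  have hmono : Monotone A := monotone_nat_of_le_succ fun i => (subset_hull L _).trans (hA i)
  rw [coe_hull, Substructure.closure_iUnion, SetLike.mem_coe, Substructure.mem_iSup_of_directed
    (Monotone.directed_le fun i j hij => Substructure.closure_mono (hmono hij))] at hx
  obtain ⟨i, hi⟩ := hx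
  exact Set.mem_iUnion.2 ⟨i + 1, hA i hi⟩

theorem card_hull_le {A : Set 𝕄} {μ : Cardinal.{w}} (hμ : ℵ₀ ≤ μ)
    (hL : Cardinal.lift.{w} L.card ≤ Cardinal.lift.{max u v} μ) (hA : #A ≤ μ) :
    #(hull L A : Set 𝕄) ≤ μ := by
  have h := Substructure.lift_card_closure_le (L := L.sum L.skolem₁) (M := 𝕄) (s := A)
  refine lift_le.{max u v}.1 (h.trans (max_le (aleph0_le_lift.2 hμ) ?_))
  refine add_le_of_le (aleph0_le_lift.2 hμ) (lift_le.2 hA) ?_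
  refine (lift_le.2 card_functions_sum_skolem₁_le).trans ?_
  rw [lift_max, lift_aleph0]
  exact max_le (aleph0_le_lift.2 hμ) hL

end Hull

/-! ### Trees of finite sequences of natural numbers -/

section Tree

variable {L : FirstOrder.Language.{u, v}} {𝕄 : Type w} [L.Structure 𝕄]

/-- The formula in the variables `V` saying that the formulas `φ(x; e i)`, `i : ι`, have a common
solution. -/
noncomputable def commonSolution {α β ι V : Type*} [Finite α] [Finite ι]
    (φ : L.Formula (α ⊕ β)) (e : ι → β → V) : L.Formula V :=
  (Formula.iInf fun i => φ.relabel (Sum.elim Sum.inr (Sum.inl ∘ e i)) :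
    L.Formula (V ⊕ α)).iExs α

theorem realize_commonSolution {α β ι V : Type*} [Finite α] [Finite ι]
    (φ : L.Formula (α ⊕ β)) (e : ι → β → V) (w : V → 𝕄) :
    (commonSolution φ e).Realize w ↔ ∃ x : α → 𝕄, ∀ i, φ.Realize (Sum.elim x (w ∘ e i)) := by
  rw [commonSolution, Formula.realize_iExs]
  refine exists_congr fun x => ?_
  rw [Formula.realize_iInf]
  refine forall_congr' fun i => ?_
  rw [Formula.realize_relabel]
  apply iff_of_eq
  congr 1
  ext (j | j) <;> rfl

/-- Consistency and inconsistency of finitely many instances of `φ`, some at fixed tuples from `A`,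
thereby pass to limits along filters. -/
theorem definable_commonSolution {α β ι V : Type*} [Finite α] [Finite ι] (φ : L.Formula (α ⊕ β))
    (e : ι → β → V) {A : Set 𝕄} {P : Set (β → 𝕄)} (hP : P.Finite) (hPA : ∀ y ∈ P, ∀ i, y i ∈ A) :
    A.Definable L {w : V → 𝕄 | ∃ x : α → 𝕄, (∀ y ∈ P, φ.Realize (Sum.elim x y)) ∧
      ∀ i, φ.Realize (Sum.elim x (w ∘ e i))} := by
  have := hP.to_subtype
  convert Set.Definable.definable_realize_left (A := A)
    (commonSolution φ (V := V ⊕ P × β)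
      (Sum.elim (fun y j => Sum.inr (y, j)) fun i j => Sum.inl (e i j) : P ⊕ ι → _))
    (b := fun z => z.1.1 z.2) (fun z => hPA _ z.1.2 z.2) using 1
  ext w
  simp only [Set.mem_ofPred_eq, realize_commonSolution, Sum.forall, Subtype.forall]
  rfl

/-- A tree of parameters for `φ(x; y)` whose branches are consistent together with `P₀`, and whose
members are all inconsistent with the members of `P₁`; a node is inconsistent with everything above
the siblings to its right. -/
structure IsTreeOver {α β : Type*} (φ : L.Formula (α ⊕ β)) (P₀ P₁ : Set (β → 𝕄))
    (b : List ℕ → β → 𝕄) : Prop where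
  branch : ∀ s : List ℕ, ∃ x : α → 𝕄, (∀ y ∈ P₀, φ.Realize (Sum.elim x y)) ∧
    ∀ k : Fin (s.length + 1), φ.Realize (Sum.elim x (b (s.take k)))
  past : ∀ y ∈ P₁, ∀ s, ¬ ∃ x : α → 𝕄, φ.Realize (Sum.elim x y) ∧ φ.Realize (Sum.elim x (b s))
  siblings : ∀ (s t : List ℕ) (p q : ℕ), p < q → ¬ ∃ x : α → 𝕄,
    φ.Realize (Sum.elim x (b (s ++ [p]))) ∧ φ.Realize (Sum.elim x (b (s ++ q :: t)))

/-- The node of the binary tree that is coded by a sequence of natural numbers. -/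
def binaryCode (s : List ℕ) : List Bool :=
  s.flatMap fun k => List.replicate k false ++ [true]

/-- Coding `k` by `0ᵏ1`, a child `p` ends in `1` just where everything above a later sibling `q > p`
continues with `0`: the inconsistent pattern of SOP₁. -/
theorem FormulaHasSOP1.exists_isTreeOver {α β : Type*} {φ : L.Formula (α ⊕ β)}
    (h : FormulaHasSOP1 𝕄 φ) : ∃ b : List ℕ → β → 𝕄, IsTreeOver φ ∅ ∅ b := by
  obtain ⟨a, hcons, hinc⟩ := h
  refine ⟨fun s => a (binaryCode s), fun s => ?_, by simp, fun s t p q hpq => ?_⟩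
  · obtain ⟨x, hx⟩ := hcons (fun i => (binaryCode s).getD i false)
      (Finset.range ((binaryCode s).length + 1))
    refine ⟨x, by simp, fun k => ?_⟩
    have hpre : binaryCode (s.take k) <+: binaryCode s := by
      refine ⟨binaryCode (s.drop k), ?_⟩
      rw [binaryCode, binaryCode, ← List.flatMap_append, List.take_append_drop, binaryCode]
    convert hx (binaryCode (s.take k)).length
      (Finset.mem_range.2 (Nat.lt_succ_of_le hpre.length_le)) using 4
    refine List.ext_getElem (by simp) fun i h1 h2 => ?_
    rw [List.getElem_ofFn, List.getD_eq_getElem _ _ (h1.trans_le hpre.length_le)]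
    exact hpre.getElem h1
  · have := hinc (binaryCode s ++ List.replicate p false) (binaryCode (s ++ q :: t)) ?_
    · rintro ⟨x, hx, hx'⟩
      refine this ⟨x, hx', ?_⟩
      simpa [binaryCode] using hx
    · obtain ⟨r, rfl⟩ := Nat.exists_eq_add_of_lt hpq
      refine ⟨List.replicate r false ++ true :: binaryCode t, ?_⟩
      have : List.replicate (p + r + 1) false
          = List.replicate p false ++ false :: List.replicate r false := by
        rw [add_assoc, List.replicate_add, List.replicate_succ]
      simp [binaryCode, this]

/-- Saturated structures realize the complete types in countably many variables of elementarily
equivalent structures. -/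
theorem IsSaturated.exists_realize_of_isComplete {κ : Cardinal.{w}} (hsat : IsSaturated L 𝕄 κ)
    (hκ : ℵ₀ < κ) [Nonempty 𝕄] {T : L.Theory} (hT : T.IsComplete) (h𝕄 : 𝕄 ⊨ T)
    {𝕌 : Type*} [L.Structure 𝕌] [Nonempty 𝕌] (h𝕌 : 𝕌 ⊨ T) {V : Type*} [Countable V]
    (b : V → 𝕌) : ∃ w : V → 𝕄, ∀ θ : L.Formula V, θ.Realize b ↔ θ.Realize w := by
  classical
  -- The existential closure of `θ` is a sentence, to which the complete theory gives the same truth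
  -- value in both structures.
  have key : ∀ θ : L.Formula V, θ.Realize b → ∃ w : V → 𝕄, θ.Realize w := by
    intro θ hθ
    let θ' : L.Formula (Empty ⊕ θ.freeVarFinset) := θ.restrictFreeVar Sum.inr
    have h1 : 𝕌 ⊨ (θ'.iExs θ.freeVarFinset : L.Sentence) := by
      refine Formula.realize_iExs.2 ⟨fun i => b i, ?_⟩
      exact (BoundedFormula.realize_restrictFreeVar (f := Sum.inr)
        (v := Sum.elim default fun i : θ.freeVarFinset => b i) b fun _ => rfl).2 hθ
    have h2 : 𝕄 ⊨ (θ'.iExs θ.freeVarFinset : L.Sentence) :=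
      (hT.realize_sentence_iff _ 𝕄).2 ((hT.realize_sentence_iff _ 𝕌).1 h1)
    obtain ⟨i, hi⟩ := Formula.realize_iExs.1 h2
    let w : V → 𝕄 := fun j => if h : j ∈ θ.freeVarFinset then i ⟨j, h⟩ else Classical.arbitrary 𝕄
    exact ⟨w, (BoundedFormula.realize_restrictFreeVar w fun j => by simp [w]).1 hi⟩
  let S := {θ : L.Formula V // θ.Realize b}
  have : Nonempty S := ⟨⟨⊤, Formula.realize_top.2 trivial⟩⟩
  let E : S → Set (V → 𝕄) := fun θ => {w | θ.1.Realize w}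
  have hdir : Directed (· ≥ ·) fun θ => 𝓟 (E θ) := by
    intro θ θ'
    refine ⟨⟨θ.1 ⊓ θ'.1, Formula.realize_inf.2 ⟨θ.2, θ'.2⟩⟩, ?_, ?_⟩ <;>
      refine principal_mono.2 fun w hw => ?_
    exacts [(Formula.realize_inf.1 hw).1, (Formula.realize_inf.1 hw).2]
  have : (⨅ θ, 𝓟 (E θ)).NeBot :=
    (iInf_neBot_iff_of_directed hdir).2 fun θ => principal_neBot_iff.2 (key θ.1 θ.2)
  obtain ⟨w, hw⟩ := hsat.exists_mem hκ (A := ∅) (by simpa using aleph0_pos.trans hκ)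
    (⨅ θ, 𝓟 (E θ))
  have hw' : ∀ θ : L.Formula V, θ.Realize b → θ.Realize w := fun θ hθ =>
    hw (E ⟨θ, hθ⟩) (mem_iInf_of_mem (⟨θ, hθ⟩ : S) (mem_principal_self _))
      (Set.empty_definable_iff.2 ⟨θ, rfl⟩)
  refine ⟨w, fun θ => ⟨hw' θ, fun h => ?_⟩⟩
  by_contra hθ
  exact Formula.realize_not.1 (hw' θ.not (Formula.realize_not.2 hθ)) h

/-- Each tree condition concerns finitely many nodes, so it is part of the type of the whole tree.
-/
theorem IsTreeOver.congr {𝕌 : Type*} [L.Structure 𝕌] {α β : Type*} [Finite α]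
    {φ : L.Formula (α ⊕ β)} {b : List ℕ → β → 𝕌} (hb : IsTreeOver φ ∅ ∅ b)
    {b' : List ℕ → β → 𝕄} (h : ∀ θ : L.Formula (List ℕ × β),
      θ.Realize (fun z => b z.1 z.2) ↔ θ.Realize (fun z => b' z.1 z.2)) :
    IsTreeOver φ ∅ ∅ b' := by
  have key : ∀ {k : ℕ} (e : Fin k → List ℕ), (∃ x : α → 𝕌, ∀ i, φ.Realize (Sum.elim x (b (e i)))) ↔
      ∃ x : α → 𝕄, ∀ i, φ.Realize (Sum.elim x (b' (e i))) := fun e => by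
    have := h (commonSolution φ fun i j => (e i, j))
    rwa [realize_commonSolution, realize_commonSolution] at this
  refine ⟨fun s => ?_, by simp, fun s t p q hpq => ?_⟩
  · obtain ⟨x, -, hx⟩ := hb.branch s
    obtain ⟨x', hx'⟩ := (key fun k : Fin (s.length + 1) => s.take k).1 ⟨x, hx⟩
    exact ⟨x', by simp, hx'⟩
  · have := key ![s ++ [p], s ++ q :: t]
    simp only [Fin.forall_fin_two, Matrix.cons_val_zero, Matrix.cons_val_one] at this
    exact fun hx => hb.siblings s t p q hpq (this.2 hx)

/-- Passing to the tree above a node on the first level, up to equivalence over `A`. -/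
theorem IsTreeOver.exists_step {κ : Cardinal.{w}} (hsat : IsSaturated L 𝕄 κ)
    (hκ : ℵ₀ < κ) [Nonempty 𝕄] {α β : Type*} [Finite α] [Finite β] {φ : L.Formula (α ⊕ β)}
    {A : Set 𝕄} (hA : #A < κ) {P₀ P₁ : Set (β → 𝕄)} {b : List ℕ → β → 𝕄}
    (hb : IsTreeOver φ P₀ P₁ b) (hP₀ : P₀.Finite) (hP₀A : ∀ y ∈ P₀, ∀ i, y i ∈ A)
    (hP₁A : ∀ y ∈ P₁, ∀ i, y i ∈ A) (hbA : ∀ i, b [] i ∈ A) :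
    ∃ (c : β → 𝕄) (b' : List ℕ → β → 𝕄), IsTreeOver φ (insert (b []) P₀) (insert c P₁) b' ∧
      ∀ D : Set (β → 𝕄), A.Definable L D → (b' [] ∈ D ↔ c ∈ D) := by
  let V := β ⊕ List ℕ × β
  -- The node `[p]` together with the subtree above `[q]`. The limit is taken first in `q`, then in
  -- `p`, so that `p < q` may be assumed.
  let pt : ℕ × ℕ → V → 𝕄 := fun z => Sum.elim (b [z.1]) fun y => b (z.2 :: y.1) y.2
  let U := hyperfilter ℕ
  have : ((U : Filter ℕ).curry (U : Filter ℕ)).NeBot := by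
    refine ⟨fun h => ?_⟩
    have h' := mem_curry_iff.1 (empty_mem_iff_bot.2 h)
    simp only [Set.mem_empty_iff_false, eventually_false_iff_eq_bot] at h'
    exact U.neBot.ne (by simpa using h')
  obtain ⟨w, hw⟩ := hsat.exists_mem hκ hA (map pt ((U : Filter ℕ).curry U))
  have hlt : ∀ {D : Set (V → 𝕄)}, A.Definable L D → (∀ p q, p < q → pt (p, q) ∈ D) → w ∈ D := by
    intro D hD h
    refine hw D (eventually_curry_iff.2 (Eventually.of_forall fun p => ?_)) hD
    have : ∀ᶠ q in (U : Filter ℕ), p < q :=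
      (hyperfilter_le_cofinite.trans Nat.cofinite_eq_atTop.le) (eventually_gt_atTop p)
    exact this.mono fun q hq => h p q hq
  let f : List ℕ → β → V := fun s i => Sum.inr (s, i)
  have hpair : ∀ e e' : β → V, (∀ p q, p < q → ¬ ∃ x : α → 𝕄,
      φ.Realize (Sum.elim x (pt (p, q) ∘ e)) ∧ φ.Realize (Sum.elim x (pt (p, q) ∘ e'))) →
      ¬ ∃ x : α → 𝕄, φ.Realize (Sum.elim x (w ∘ e)) ∧ φ.Realize (Sum.elim x (w ∘ e')) := by
    intro e e' h
    have hD := (definable_commonSolution φ ![e, e'] (A := A) Set.finite_empty (by simp)).compl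
    have := hlt hD fun p q hpq => by simpa [Fin.forall_fin_two] using h p q hpq
    simpa [Fin.forall_fin_two] using this
  refine ⟨w ∘ Sum.inl, fun s => w ∘ f s, ⟨fun s => ?_, ?_, fun s t p q hpq => ?_⟩, ?_⟩
  · refine hlt (definable_commonSolution φ (fun k : Fin (s.length + 1) => f (s.take k))
      (hP₀.insert (b [])) ?_) fun p q hpq => ?_
    · rintro y (rfl | hy)
      exacts [hbA, hP₀A y hy]
    · obtain ⟨x, hx, hx'⟩ := hb.branch (q :: s)
      refine ⟨x, ?_, fun k => hx' k.succ⟩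
      rintro y (rfl | hy)
      exacts [hx' 0, hx y hy]
  · rintro y (rfl | hy) s
    · exact hpair _ _ fun p q hpq => hb.siblings [] s p q hpq
    · have hD := (definable_commonSolution φ (fun _ : Unit => f s) (A := A)
        (Set.finite_singleton y) (by simpa using hP₁A y hy)).compl
      have := hlt hD fun p q hpq => by
        simpa using! hb.past y hy (q :: s)
      simpa using this
  · exact hpair _ _ fun p' q' _ => hb.siblings (q' :: s) t p q hpq
  · intro D hD
    have h1 : A.Definable L {w : V → 𝕄 | w ∘ f [] ∈ D ↔ w ∘ Sum.inl ∈ D} := by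
      have hD₁ : A.Definable L {w : V → 𝕄 | w ∘ f [] ∈ D} := hD.preimage_comp (f [])
      have hD₂ : A.Definable L {w : V → 𝕄 | w ∘ Sum.inl ∈ D} := hD.preimage_comp Sum.inl
      convert (hD₁.himp hD₂).inter (hD₂.himp hD₁) using 1
      ext w
      simp [iff_def, Set.mem_himp_iff]
    refine hw _ (eventually_curry_iff.2 ?_) h1
    -- Both the node and the root of the subtree run through the `b [p]` along the same ultrafilter,
    -- so their limits have the same type over `A`.
    have : (∀ᶠ p in (U : Filter ℕ), b [p] ∈ D) ∨ ∀ᶠ p in (U : Filter ℕ), b [p] ∉ D :=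
      Ultrafilter.em U _
    rcases this with h | h
    · exact h.mono fun p hp => h.mono fun q hq => iff_of_true hq hp
    · exact h.mono fun p hp => h.mono fun q hq => iff_of_false hq hp

end Tree

end KimIndependence

namespace KimIndependence

open FirstOrder.Language Filter

/-! ### An array of parameters from SOP₁ -/

section Array

variable {L : FirstOrder.Language.{u, v}} {𝕄 : Type w} [L.Structure 𝕄] {κ μ : Cardinal.{w}}

/-- A set `A` of at most `μ` elements, together with a tree whose root has the same type over `A` as
the tuple `c ∈ P₁`. -/
structure Stage {α β : Type*} (φ : L.Formula (α ⊕ β)) (𝕄 : Type w) [L.Structure 𝕄]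
    (μ : Cardinal.{w}) where
  A : Set 𝕄
  P₀ : Set (β → 𝕄)
  P₁ : Set (β → 𝕄)
  b : List ℕ → β → 𝕄
  c : β → 𝕄
  card_le : #A ≤ μ
  finite₀ : P₀.Finite
  finite₁ : P₁.Finite
  isTreeOver : IsTreeOver φ P₀ P₁ b
  mem : c ∈ P₁
  equiv : ∀ D : Set (β → 𝕄), A.Definable L D → (b [] ∈ D ↔ c ∈ D)

theorem card_union_le (hμ : ℵ₀ ≤ μ) {A B : Set 𝕄} (hA : #A ≤ μ) (hB : B.Countable) :
    #(A ∪ B : Set 𝕄) ≤ μ :=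
  (mk_union_le A B).trans (add_le_of_le hμ hA (hB.le_aleph0.trans hμ))

/-- The old root joins `P₀` and the new `c` joins `P₁`, so the sets record all earlier choices. The
one-node branch of the old tree supplies `a`. -/
theorem Stage.exists_next (hsat : IsSaturated L 𝕄 κ) (hμκ : μ < κ) (hμ : ℵ₀ ≤ μ)
    (hL : Cardinal.lift.{w} L.card ≤ Cardinal.lift.{max u v} μ) [Nonempty 𝕄] {α β : Type*}
    [Finite α] [Finite β] {φ : L.Formula (α ⊕ β)} (σ : Stage φ 𝕄 μ) :
    ∃ (τ : Stage φ 𝕄 μ) (a : α → 𝕄), (hull L σ.A : Set 𝕄) ⊆ τ.A ∧ (∀ i, a i ∈ τ.A) ∧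
      (∀ i, σ.b [] i ∈ τ.A) ∧ (∀ i, σ.c i ∈ τ.A) ∧ σ.b [] ∈ τ.P₀ ∧ σ.P₀ ⊆ τ.P₀ ∧ σ.P₁ ⊆ τ.P₁ ∧
      ∀ y ∈ τ.P₀, φ.Realize (Sum.elim a y) := by
  obtain ⟨a, ha, ha'⟩ := σ.isTreeOver.branch []
  have hfin : (insert (σ.b []) (σ.P₀ ∪ σ.P₁)).Finite := (σ.finite₀.union σ.finite₁).insert _
  let B : Set 𝕄 := (⋃ y ∈ insert (σ.b []) (σ.P₀ ∪ σ.P₁), Set.range y) ∪ Set.range a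
  have hB : B.Countable :=
    ((hfin.biUnion fun y _ => Set.finite_range y).union (Set.finite_range a)).countable
  have hyB : ∀ y ∈ insert (σ.b []) (σ.P₀ ∪ σ.P₁), ∀ i, y i ∈ (hull L σ.A : Set 𝕄) ∪ B :=
    fun y hy i => Or.inr (Or.inl (Set.mem_biUnion hy (Set.mem_range_self i)))
  have hcard : #((hull L σ.A : Set 𝕄) ∪ B : Set 𝕄) ≤ μ :=
    card_union_le hμ (card_hull_le L hμ hL σ.card_le) hB
  obtain ⟨c, b, hb, hcb⟩ := σ.isTreeOver.exists_step hsat (hμ.trans_lt hμκ)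
    (hcard.trans_lt hμκ) σ.finite₀ (fun y hy => hyB y (Or.inr (Or.inl hy)))
    (fun y hy => hyB y (Or.inr (Or.inr hy))) (hyB _ (Or.inl rfl))
  refine ⟨⟨_, _, _, b, c, hcard, σ.finite₀.insert _, σ.finite₁.insert _, hb,
    Set.mem_insert _ _, hcb⟩, a, Set.subset_union_left,
    fun i => Or.inr (Or.inr (Set.mem_range_self i)), hyB _ (Or.inl rfl),
    hyB _ (Or.inr (Or.inr σ.mem)), Set.mem_insert _ _, Set.subset_insert _ _,
    Set.subset_insert _ _, ?_⟩
  rintro y (rfl | hy)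
  exacts [ha' 0, ha y hy]

theorem IsTreeOver.exists_stage (hsat : IsSaturated L 𝕄 κ) (hμκ : μ < κ) (hμ : ℵ₀ ≤ μ)
    [Nonempty 𝕄] {α β : Type*} [Finite α] [Finite β] {φ : L.Formula (α ⊕ β)}
    {b : List ℕ → β → 𝕄} (hb : IsTreeOver φ ∅ ∅ b) : Nonempty (Stage φ 𝕄 μ) := by
  have hcard : #(Set.range (b [])) ≤ μ := (Set.countable_range _).le_aleph0.trans hμ
  obtain ⟨c, b', hb', hcb⟩ := hb.exists_step hsat (hμ.trans_lt hμκ) (hcard.trans_lt hμκ)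
    Set.finite_empty (by simp) (by simp) Set.mem_range_self
  exact ⟨⟨_, _, _, b', c, hcard, Set.finite_empty.insert _, Set.finite_empty.insert _, hb',
    Set.mem_insert _ _, hcb⟩⟩

/-- An increasing sequence of small sets `A i`, whose union is a model, and an array `(c₀ i, c₁ i)`
with `c₀ i ≡ c₁ i` over `A i`, such that `φ(x; c₁ j)` and `φ(x; c₀ i)` are inconsistent for `j ≤ i`
while `a i` realizes `φ(x; c₀ j)` for `j ≤ i`. -/
theorem IsTreeOver.exists_array (hsat : IsSaturated L 𝕄 κ) (hμκ : μ < κ) (hμ : ℵ₀ ≤ μ)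
    (hL : Cardinal.lift.{w} L.card ≤ Cardinal.lift.{max u v} μ) [Nonempty 𝕄] {α β : Type*}
    [Finite α] [Finite β] {φ : L.Formula (α ⊕ β)} {b : List ℕ → β → 𝕄}
    (hb : IsTreeOver φ ∅ ∅ b) :
    ∃ (A : ℕ → Set 𝕄) (a : ℕ → α → 𝕄) (c₀ c₁ : ℕ → β → 𝕄),
      (∀ i, #(A i) ≤ μ) ∧ (∀ i, (hull L (A i) : Set 𝕄) ⊆ A (i + 1)) ∧
      (∀ i j, a i j ∈ A (i + 1)) ∧ (∀ i j, c₀ i j ∈ A (i + 1)) ∧ (∀ i j, c₁ i j ∈ A (i + 1)) ∧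
      (∀ i j, j ≤ i → φ.Realize (Sum.elim (a i) (c₀ j))) ∧
      (∀ i j, j ≤ i → ¬ ∃ x : α → 𝕄,
        φ.Realize (Sum.elim x (c₁ j)) ∧ φ.Realize (Sum.elim x (c₀ i))) ∧
      ∀ i, ∀ D : Set (β → 𝕄), (A i).Definable L D → (c₀ i ∈ D ↔ c₁ i ∈ D) := by
  obtain ⟨σ₀⟩ := hb.exists_stage hsat hμκ hμ
  choose next a h1 h2 h3 h4 h5 h6 h7 h8 using
    fun σ : Stage φ 𝕄 μ => σ.exists_next hsat hμκ hμ hL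
  let σ : ℕ → Stage φ 𝕄 μ := fun i => next^[i] σ₀
  have hσ : ∀ i, σ (i + 1) = next (σ i) := fun i => Function.iterate_succ_apply' _ _ _
  have m₀ : Monotone fun i => (σ i).P₀ := monotone_nat_of_le_succ fun i => by
    rw [hσ]; exact h6 _
  have m₁ : Monotone fun i => (σ i).P₁ := monotone_nat_of_le_succ fun i => by
    rw [hσ]; exact h7 _
  refine ⟨fun i => (σ i).A, fun i => a (σ i), fun i => (σ i).b [], fun i => (σ i).c,
    fun i => (σ i).card_le, fun i => ?_, fun i => ?_, fun i => ?_, fun i => ?_,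
    fun i j hij => ?_, fun i j hij => ?_, fun i => (σ i).equiv⟩
  · beta_reduce; rw [hσ]; exact h1 _
  · beta_reduce; rw [hσ]; exact h2 _
  · beta_reduce; rw [hσ]; exact h3 _
  · beta_reduce; rw [hσ]; exact h4 _
  -- The tuple `a (σ i)` works for all of `P₀` at stage `i + 1`, which contains the roots of stages
  -- up to and including `i`.
  · refine h8 (σ i) _ ?_
    rw [← hσ]
    refine m₀ (Nat.succ_le_succ hij) ?_
    simp only [Nat.succ_eq_add_one, hσ]
    exact h5 _
  · exact (σ i).isTreeOver.past _ (m₁ hij (σ j).mem) []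

end Array

/-! ### Averages along ultrafilters -/

section Average

variable {L : FirstOrder.Language.{u, v}} {𝕄 : Type w} [L.Structure 𝕄] {κ μ : Cardinal.{w}}

/-- The global type of the formulas satisfied by almost all `a i`. -/
def average (L : FirstOrder.Language.{u, v}) {𝕄 : Type w} [L.Structure 𝕄] {ι α : Type*}
    (U : Ultrafilter ι) (a : ι → α → 𝕄) : GlobalType L 𝕄 α where
  carrier := {φ | ∀ᶠ i in (U : Filter ι), φ.Realize (Sum.elim (a i) id)}
  finSat s hs :=
    let ⟨i, hi⟩ := ((Filter.eventually_all_finset s).2 fun φ hφ => hs hφ).exists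
    ⟨a i, hi⟩
  complete φ := by
    simp only [Set.mem_ofPred_eq, Formula.realize_not]
    exact Ultrafilter.em U _

theorem average_contains {ι α β : Type*} {U : Ultrafilter ι} {a : ι → α → 𝕄}
    {φ : L.Formula (α ⊕ β)} {b : β → 𝕄} : (average L U a).Contains φ b ↔
      ∀ᶠ i in (U : Filter ι), φ.Realize (Sum.elim (a i) b) := by
  simp only [GlobalType.Contains, average, Set.mem_ofPred_eq, Formula.realize_relabel,
    Sum.elim_comp_map, Function.comp_id, Function.id_comp]

theorem mem_iff_of_typeOver_eq {α : Type*} {A : Set 𝕄} {b b' : α → 𝕄}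
    (h : typeOver L b A = typeOver L b' A) {D : Set (α → 𝕄)} (hD : A.Definable L D) :
    b ∈ D ↔ b' ∈ D := by
  obtain ⟨ψ, hψ⟩ := hD.exists_formula
  rw [hψ, hψ]
  exact Set.ext_iff.1 h ψ

/-- Since `a i` lies in `A`, the truth of `φ(a i; b)` depends only on `tp(b/A)`. -/
theorem average_isInvariant {ι α : Type*} {U : Ultrafilter ι} {a : ι → α → 𝕄} {A : Set 𝕄}
    (ha : ∀ i j, a i j ∈ A) : (average L U a).IsInvariant A := fun n φ b b' h => by
  rw [average_contains, average_contains]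
  exact eventually_congr (Eventually.of_forall fun i =>
    mem_iff_of_typeOver_eq h (Set.Definable.definable_realize_right φ (ha i)))

/-- `x` realizes the average of `a` over `A`. -/
def RealizesAverage (L : FirstOrder.Language.{u, v}) {𝕄 : Type w} [L.Structure 𝕄] {ι α : Type*}
    (U : Ultrafilter ι) (a : ι → α → 𝕄) (A : Set 𝕄) (x : α → 𝕄) : Prop :=
  ∀ D : Set (α → 𝕄), A.Definable L D → (x ∈ D ↔ ∀ᶠ i in (U : Filter ι), a i ∈ D)

theorem RealizesAverage.mono {ι α : Type*} {U : Ultrafilter ι} {a : ι → α → 𝕄} {A B : Set 𝕄}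
    {x : α → 𝕄} (h : RealizesAverage L U a B x) (hAB : A ⊆ B) : RealizesAverage L U a A x :=
  fun D hD => h D (hD.mono hAB)

theorem RealizesAverage.realizes {ι α : Type*} {U : Ultrafilter ι} {a : ι → α → 𝕄} {A : Set 𝕄}
    {x : α → 𝕄} (h : RealizesAverage L U a A x) : Realizes x ((average L U a).restrict A) :=
  fun φ hφ => (h _ (Set.Definable.definable_realize_left φ fun c => c.2)).2
    (average_contains.1 hφ)

theorem IsSaturated.exists_realizesAverage (hsat : IsSaturated L 𝕄 κ) (hκ : ℵ₀ < κ) [Nonempty 𝕄]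
    {ι α : Type*} [Finite α] (U : Ultrafilter ι) (a : ι → α → 𝕄) {A : Set 𝕄} (hA : #A < κ) :
    ∃ x, RealizesAverage L U a A x := by
  obtain ⟨x, hx⟩ := hsat.exists_mem hκ hA (map a U)
  refine ⟨x, fun D hD => ⟨fun hxD => ?_, fun h => hx D h hD⟩⟩
  by_contra h
  exact hx Dᶜ (Ultrafilter.eventually_not.2 h) hD.compl hxD

/-- Successive realizations of an average over larger and larger sets whose union is a model. -/
theorem IsSaturated.exists_average_chain (hsat : IsSaturated L 𝕄 κ) (hμκ : μ < κ) (hμ : ℵ₀ ≤ μ)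
    (hL : Cardinal.lift.{w} L.card ≤ Cardinal.lift.{max u v} μ) [Nonempty 𝕄] {ι α : Type*}
    [Finite α] (U : Ultrafilter ι) (a : ι → α → 𝕄) {A : Set 𝕄} (hA : #A ≤ μ) :
    ∃ (B : ℕ → Set 𝕄) (x : ℕ → α → 𝕄), B 0 = A ∧ (∀ i, #(B i) ≤ μ) ∧
      (∀ i, (hull L (B i) : Set 𝕄) ⊆ B (i + 1)) ∧ (∀ i j, x i j ∈ B (i + 1)) ∧
      ∀ i, RealizesAverage L U a (B i) (x i) := by
  choose x hx using fun B : {B : Set 𝕄 // #B ≤ μ} =>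
    hsat.exists_realizesAverage (hμ.trans_lt hμκ) U a (B.2.trans_lt hμκ)
  let next : {B : Set 𝕄 // #B ≤ μ} → {B : Set 𝕄 // #B ≤ μ} := fun B =>
    ⟨(hull L B.1 : Set 𝕄) ∪ Set.range (x B),
      card_union_le hμ (card_hull_le L hμ hL B.2) (Set.countable_range _)⟩
  let B : ℕ → {B : Set 𝕄 // #B ≤ μ} := fun i => next^[i] ⟨A, hA⟩
  have hB : ∀ i, B (i + 1) = next (B i) := fun i => Function.iterate_succ_apply' _ _ _
  refine ⟨fun i => (B i).1, fun i => x (B i), rfl, fun i => (B i).2, fun i => ?_, fun i j => ?_,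
    fun i => hx (B i)⟩
  · simp only [hB]; exact Set.subset_union_left
  · simp only [hB]; exact Or.inr (Set.mem_range_self j)

theorem monotone_of_hull_subset [Nonempty 𝕄] {A : ℕ → Set 𝕄}
    (hA : ∀ i, (hull L (A i) : Set 𝕄) ⊆ A (i + 1)) : Monotone A :=
  monotone_nat_of_le_succ fun i => (subset_hull L _).trans (hA i)

theorem IsSaturated.exists_isMorleySeq (hsat : IsSaturated L 𝕄 κ) (hμκ : μ < κ) (hμ : ℵ₀ ≤ μ)
    (hL : Cardinal.lift.{w} L.card ≤ Cardinal.lift.{max u v} μ) [Nonempty 𝕄] {ι α : Type*}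
    [Finite α] (U : Ultrafilter ι) (a : ι → α → 𝕄) {A : Set 𝕄} (hA : #A ≤ μ) :
    ∃ I : ℕ → α → 𝕄, IsMorleySeq (average L U a) A I ∧
      ∀ i, RealizesAverage L U a (A ∪ ⋃ j : Fin i, Set.range (I j)) (I i) := by
  obtain ⟨B, I, rfl, -, hB, hIB, hI⟩ := hsat.exists_average_chain hμκ hμ hL U a hA
  have hmono := monotone_of_hull_subset hB
  have h : ∀ i, RealizesAverage L U a (B 0 ∪ ⋃ j : Fin i, Set.range (I j)) (I i) := by
    refine fun i => (hI i).mono (Set.union_subset (hmono (Nat.zero_le i))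
      (Set.iUnion_subset fun j => ?_))
    rintro _ ⟨k, rfl⟩
    exact hmono j.2 (hIB j k)
  exact ⟨I, fun i => (h i).realizes, h⟩

end Average

end KimIndependence

namespace KimIndependence

theorem card_iUnion_le {𝕄 : Type w} {μ : Cardinal.{w}} (hμ : ℵ₀ ≤ μ) {A : ℕ → Set 𝕄}
    (hA : ∀ i, #(A i) ≤ μ) : #(⋃ i, A i : Set 𝕄) ≤ μ := by
  have h := mk_iUnion_le_lift A
  simp only [lift_uzero, mk_nat, lift_aleph0] at h
  exact h.trans ((mul_le_mul' le_rfl (ciSup_le' hA)).trans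
    ((mul_le_mul' hμ le_rfl).trans (mul_eq_self hμ).le))

end KimIndependence

/-! ### Failure of Kim-independence from SOP₁ -/

open KimIndependence FirstOrder.Language Filter in
theorem mainTheorem2 {L : FirstOrder.Language.{u, v}} (T : L.Theory) (hT : T.IsComplete)
    (hSOP : KimIndependence.HasSOP1 T)
    (𝕄 : Type w) [L.Structure 𝕄] [Nonempty 𝕄] (h𝕄 : 𝕄 ⊨ T)
    (κ : Cardinal.{w}) (hκ : ℵ₀ < κ)
    (hLκ : Cardinal.lift.{w} L.card < Cardinal.lift.{max u v} κ)
    (hsat : KimIndependence.IsSaturated L 𝕄 κ) :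
    ∃ (M N : L.ElementarySubstructure 𝕄) (m n : ℕ) (a : Fin m → 𝕄) (c : Fin n → 𝕄),
      M ≤ N ∧ #N < κ ∧
      KimIndependence.CoheirIndep M a (N : Set 𝕄) ∧
      KimIndependence.CoheirIndep N a (Set.range c) ∧
      ¬ KimIndependence.KimIndep M a ((N : Set 𝕄) ∪ Set.range c) := by
  obtain ⟨μ, hμ, hμκ, hL⟩ : ∃ μ : Cardinal.{w}, ℵ₀ ≤ μ ∧ μ < κ ∧
      Cardinal.lift.{w} L.card ≤ Cardinal.lift.{max u v} μ := by
    obtain ⟨ν, hν⟩ := mem_range_lift_of_le hLκ.le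
    refine ⟨max ℵ₀ ν, le_max_left _ _, max_lt hκ ?_, ?_⟩
    · rwa [← hν, lift_lt] at hLκ
    · rw [← hν]
      exact lift_le.2 (le_max_right _ _)
  obtain ⟨m, n, φ, 𝕌, h𝕌⟩ := hSOP
  obtain ⟨b₀, hb₀⟩ := h𝕌.exists_isTreeOver
  obtain ⟨w, hw⟩ := hsat.exists_realize_of_isComplete hκ hT h𝕄 𝕌.is_model
    fun z : List ℕ × Fin n => b₀ z.1 z.2
  have hb : IsTreeOver φ ∅ ∅ (fun s i => w (s, i)) := hb₀.congr hw
  obtain ⟨A, a, c₀, c₁, hAμ, hA, haA, hc₀A, hc₁A, hac, hinc, heq⟩ :=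
    hb.exists_array hsat hμκ hμ hL
  have hAmono := monotone_of_hull_subset hA
  have hM := coe_hull_iUnion L hA
  generalize hull L (⋃ i, A i) = M at hM
  have hMμ : #(M : Set 𝕄) ≤ μ := by
    rw [hM]
    exact card_iUnion_le hμ hAμ
  have haM : ∀ i j, a i j ∈ (M : Set 𝕄) := fun i j => hM ▸ Set.mem_iUnion.2 ⟨i + 1, haA i j⟩
  have hc₀M : ∀ i j, c₀ i j ∈ (M : Set 𝕄) := fun i j => hM ▸ Set.mem_iUnion.2 ⟨i + 1, hc₀A i j⟩
  have hc₁M : ∀ i j, c₁ i j ∈ (M : Set 𝕄) := fun i j => hM ▸ Set.mem_iUnion.2 ⟨i + 1, hc₁A i j⟩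
  let U := hyperfilter ℕ
  have hU : ∀ k, ∀ᶠ i in (U : Filter ℕ), k ≤ i := fun k =>
    (hyperfilter_le_cofinite.trans Nat.cofinite_eq_atTop.le) (eventually_ge_atTop k)
  -- The averages of `c₀` and of `c₁` agree over `M`.
  have heqM : ∀ D : Set (Fin n → 𝕄), (M : Set 𝕄).Definable L D →
      ((∀ᶠ i in (U : Filter ℕ), c₀ i ∈ D) ↔ ∀ᶠ i in (U : Filter ℕ), c₁ i ∈ D) := by
    intro D hD
    rw [hM] at hD
    obtain ⟨k, hk⟩ := hD.exists_of_iUnion hAmono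
    exact eventually_congr ((hU k).mono fun i hi => heq i D (hk.mono (hAmono hi)))
  obtain ⟨B, a', hB0, hBμ, hB, haB, ha'⟩ := hsat.exists_average_chain hμκ hμ hL U a hMμ
  have hBmono := monotone_of_hull_subset hB
  have hN := coe_hull_iUnion L hB
  generalize hull L (⋃ i, B i) = N at hN
  have hNμ : #(N : Set 𝕄) ≤ μ := by
    rw [hN]
    exact card_iUnion_le hμ hBμ
  have hMN : (M : Set 𝕄) ⊆ N := by
    rw [hN, ← hB0]
    exact Set.subset_iUnion B 0
  have ha'N : ∀ i j, a' i j ∈ (N : Set 𝕄) := fun i j => hN ▸ Set.mem_iUnion.2 ⟨i + 1, haB i j⟩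
  have ha'M : ∀ i, RealizesAverage L U a M (a' i) := fun i =>
    (ha' i).mono (hB0 ▸ hBmono (Nat.zero_le i))
  obtain ⟨c, hc⟩ := hsat.exists_realizesAverage hκ U c₀ (hNμ.trans_lt hμκ)
  have hNcκ : #((N : Set 𝕄) ∪ Set.range c : Set 𝕄) < κ :=
    card_union_lt hκ (hNμ.trans_lt hμκ) (Set.countable_range c)
  obtain ⟨d, hd⟩ := hsat.exists_realizesAverage hκ U a' hNcκ
  -- `d` realizes `φ(x; c)`.
  have ha'c : ∀ i, φ.Realize (Sum.elim (a' i) c) := by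
    intro i
    refine (hc _ (Set.Definable.definable_realize_right φ (ha'N i))).2
      (Eventually.of_forall fun j => ?_)
    refine (ha'M i _ (Set.Definable.definable_realize_left φ (hc₀M j))).2 ?_
    exact (hU j).mono fun k hk => hac k j hk
  have hdc : φ.Realize (Sum.elim d c) :=
    (hd _ (Set.Definable.definable_realize_left φ
      fun i => Set.mem_union_right _ (Set.mem_range_self i))).2 (Eventually.of_forall ha'c)
  refine ⟨M, N, m, n, d, c, hMN, hNμ.trans_lt hμκ, fun ψ hψ => ?_, fun ψ hψ => ?_, fun h => h ?_⟩
  · have hD := Set.Definable.definable_realize_left (A := (N : Set 𝕄)) ψ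
      (b := fun c => c) fun c => c.2.elim (fun h => hMN h) id
    -- The parameters of `ψ` lie in some `B k`. For `i ≥ k`, `a' i` realizes the average of `a` over
    -- `B k`, so `ψ` passes from `d` to some `a' i` and from there to some `a j` in `M`.
    have hev := (hd _ (hD.mono Set.subset_union_left)).1 hψ
    obtain ⟨k, hk⟩ := Set.Definable.exists_of_iUnion hBmono (hD.mono hN.subset)
    obtain ⟨i, hki, hi⟩ := ((hU k).and hev).exists
    obtain ⟨j, hj⟩ := ((ha' i _ (hk.mono (hBmono hki))).1 hi).exists
    exact ⟨a j, haM j, hj⟩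
  · obtain ⟨i, hi⟩ := ((hd _ (Set.Definable.definable_realize_left ψ fun c => c.2)).1 hψ).exists
    exact ⟨a' i, ha'N i, hi⟩
  · let B : Set 𝕄 := (M : Set 𝕄) ∪ ((N : Set 𝕄) ∪ Set.range c)
    let e : Fin n → B := fun i => ⟨c i, Or.inr (Or.inr (Set.mem_range_self i))⟩
    have he : ∀ x : Fin m → 𝕄, (φ.relabel (Sum.map id e)).Realize
        (Sum.elim x fun b : B => (b : 𝕄)) ↔ φ.Realize (Sum.elim x c) := fun x => by
      rw [Formula.realize_relabel, Sum.elim_comp_map]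
      rfl
    refine ⟨n, φ, c, ⟨{φ.relabel (Sum.map id e)}, by simpa [typeOver] using! (he d).2 hdc,
      fun x hx => (he x).1 (hx _ (by simp))⟩, 1, fun _ => n, fun _ => φ, fun _ => c,
      fun _ => ?_, fun x hx => ⟨0, hx⟩⟩
    -- The average of `c₁`, not of `c₀`, witnesses Kim-dividing; it extends `tp(c/M)` because the
    -- two agree over `M`.
    obtain ⟨I, hI, hI'⟩ := hsat.exists_isMorleySeq hμκ hμ hL U c₁ hMμ
    refine ⟨average L U c₁, average_isInvariant hc₁M, fun ψ hψ => ?_, I, hI, fun hcons => ?_⟩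
    · have hD := Set.Definable.definable_realize_left (A := (M : Set 𝕄)) ψ
        (b := fun c => c) fun c => c.2
      exact average_contains.2 ((heqM _ hD).1 ((hc _ (hD.mono hMN)).1 hψ))
    · obtain ⟨x, hx⟩ := hcons {0, 1}
      -- `φ(x; y)` and `φ(x; z)` are inconsistent for `y` in the sequence `c₁` and `z = I 0`.
      have h0 : ∀ j, ¬ ∃ x : Fin m → 𝕄,
          φ.Realize (Sum.elim x (c₁ j)) ∧ φ.Realize (Sum.elim x (I 0)) := by
        intro j
        have hD := (definable_commonSolution φ (fun _ : Unit => id) (A := (M : Set 𝕄))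
          (Set.finite_singleton (c₁ j)) (by simpa using hc₁M j)).compl
        -- Over `M`, `I 0` also realizes the average of `c₀`, and `c₀ i` is incompatible with `c₁ j`
        -- once `i ≥ j`.
        have := ((hI' 0).mono Set.subset_union_left _ hD).2 ((heqM _ hD).1
          ((hU j).mono fun i hi => by simpa using! hinc i j hi))
        simpa using! this
      have hI0 : ∀ y ∈ ({I 0} : Set (Fin n → 𝕄)), ∀ i,
          y i ∈ (M : Set 𝕄) ∪ ⋃ j : Fin 1, Set.range (I j) := by
        rintro _ rfl i
        exact Or.inr (Set.mem_iUnion.2 ⟨0, Set.mem_range_self i⟩)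
      have hD := (definable_commonSolution φ (fun _ : Unit => id) (Set.finite_singleton (I 0))
        hI0).compl
      -- Incompatibility with `I 0` is definable over `I 0` and holds for every `c₁ j`, so it passes
      -- to `I 1`.
      have := (hI' 1 _ hD).2 (Eventually.of_forall fun j => by
        simpa [and_comm] using! h0 j)
      refine this ⟨x, ?_, fun _ => hx 1 (by simp)⟩
      rintro _ rfl
      exact hx 0 (by simp)
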